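/- For $w\in\mathbb C$ let $\sqrt w$ denote the square root $\sqrt{r e^{i\theta}}=\sqrt r\,e^{i\theta/2}$, $\theta\in[0,2\pi)$, i.e. the square root with nonnegative imaginary part whenever $w\notin[0,\infty)$; thus $\sqrt{i}=\frac{1+i}{\sqrt2}$ and $\sqrt{-i}=\frac{-1+i}{\sqrt2}$. On $L^2(0,\infty)$ consider the differential expression $K_1=-\frac{d^2}{dx^2}$ with maximal and minimal domains $$\operatorname{dom}K_{1,\max}=\{f\in L^2(0,\infty): f,f'\in AC_{\rm loc}(0,\infty),\ -f''\in L^2(0,\infty)\},$$ $$\operatorname{dom}K_{1,\min}=\{f\in\operatorname{dom}K_{1,\max}:\ \lim_{x\to0^+}f(x)=\lim_{x\to0^+}f'(x)=0\},$$ and, for $f\in\operatorname{dom}K_{1,\max}$, put $f(0)=\lim_{x\to0^+}f(x)$ and $f'(0)=\lim_{x\to0^+}f'(x)$. Let $\phi^+(x)=\sqrt[4]{2}\,e^{\sqrt{-i}\,x}$ and $\phi^-(x)=\sqrt[4]{2}\,e^{-\sqrt{i}\,x}$ be the normalized defect vectors. For $\alpha\in\mathbb C$ with $|\alpha|=1$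 let $$\operatorname{dom}K_{1,\alpha}=\operatorname{dom}K_{1,\min}+\operatorname{span}\{\alpha\phi^--\phi^+\},$$ and for $b,c\in\mathbb C$ with $|b|=|c|=1$ and $b\overline c\in\mathbb R$ let $$\operatorname{dom}K_1(b,c)=\{f\in\operatorname{dom}K_{1,\max}:\ b f(0)+c f'(0)=0\}.$$ Then $b-c\sqrt i\ne0$, the number $\frac{b+c\sqrt{-i}}{b-c\sqrt i}$ has modulus $1$, and $$\operatorname{dom}K_{1,\alpha}=\operatorname{dom}K_1(b,c)\quad\Longleftrightarrow\quad \alpha=\frac{b+c\sqrt{-i}}{b-c\sqrt{i}}.$$ -/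

import Mathlib

open MeasureTheory Filter Topology
open scoped Pointwise

noncomputable section

namespace HalfLine

/-- The Hilbert space `L²(0, ∞)` of complex-valued functions. -/
abbrev L2 : Type := Lp ℂ 2 (volume.restrict (Set.Ioi (0 : ℝ)))

/-- The square root with values in the closed upper half-plane, i.e.
`√(r e^{iθ}) = √r e^{iθ/2}` for `r ≥ 0` and `θ ∈ [0, 2π)`. -/
def usqrt (w : ℂ) : ℂ :=
  if 0 ≤ (w ^ (1 / 2 : ℂ)).im then w ^ (1 / 2 : ℂ) else -w ^ (1 / 2 : ℂ)

theorem usqrt_sq (w : ℂ) : usqrt w ^ 2 = w := by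
  have h : (w ^ (1 / 2 : ℂ)) ^ 2 = w := by
    simp
  unfold usqrt
  split_ifs
  · exact h
  · rw [neg_sq, h]

theorem usqrt_im_nonneg (w : ℂ) : 0 ≤ (usqrt w).im := by
  unfold usqrt
  split_ifs with h
  · exact h
  · simp only [Complex.neg_im]
    linarith [not_le.mp h]

theorem usqrt_I : usqrt Complex.I = ((1 / √2 : ℝ) : ℂ) * (1 + Complex.I) := by
  have h1 := usqrt_sq Complex.I
  have h2 := usqrt_im_nonneg Complex.I
  set z := usqrt Complex.I
  have hs : (√2 : ℝ) ^ 2 = 2 := Real.sq_sqrt (by norm_num)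
  have hre : z.re * z.re - z.im * z.im = 0 := by
    have := congrArg Complex.re h1; simpa [pow_two] using this
  have him : z.re * z.im + z.im * z.re = 1 := by
    have := congrArg Complex.im h1; simpa [pow_two] using this
  have hpos : 0 < √2 := by positivity
  have e : z.re = z.im := by
    rcases mul_eq_zero.mp (show (z.re - z.im) * (z.re + z.im) = 0 by linarith) with h | h
    · linarith
    · nlinarith
  have k : z.im = 1 / √2 := by
    rw [e] at him
    rw [eq_div_iff hpos.ne']
    have : (z.im * √2) ^ 2 = 1 := by rw [mul_pow, hs]; linarith
    nlinarith [mul_nonneg h2 hpos.le]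
  apply Complex.ext <;> simp [e, k] <;> field_simp <;> simp [hs]

theorem usqrt_neg_I : usqrt (-Complex.I) = ((1 / √2 : ℝ) : ℂ) * (-1 + Complex.I) := by
  have h1 := usqrt_sq (-Complex.I)
  have h2 := usqrt_im_nonneg (-Complex.I)
  set z := usqrt (-Complex.I)
  have hs : (√2 : ℝ) ^ 2 = 2 := Real.sq_sqrt (by norm_num)
  have hre : z.re * z.re - z.im * z.im = 0 := by
    have := congrArg Complex.re h1; simpa [pow_two] using this
  have him : z.re * z.im + z.im * z.re = -1 := by
    have := congrArg Complex.im h1; simpa [pow_two] using this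
  have hpos : 0 < √2 := by positivity
  have e : z.re = -z.im := by
    rcases mul_eq_zero.mp (show (z.re - z.im) * (z.re + z.im) = 0 by linarith) with h | h
    · nlinarith
    · linarith
  have k : z.im = 1 / √2 := by
    rw [e] at him
    rw [eq_div_iff hpos.ne']
    have : (z.im * √2) ^ 2 = 1 := by rw [mul_pow, hs]; linarith
    nlinarith [mul_nonneg h2 hpos.le]
  apply Complex.ext <;> simp [e, k] <;> field_simp <;> simp [hs]

/-- `f ∈ AC_loc(0, ∞)`: absolute continuity on every compact subinterval of `(0, ∞)`. -/
def LocAC (f : ℝ → ℂ) : Prop :=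
  ∀ x y : ℝ, 0 < x → x ≤ y → AbsolutelyContinuousOnInterval f x y

/-- `g` is a representative of the class `f ∈ L²(0, ∞)` with `g, g' ∈ AC_loc(0, ∞)` and
`-g'' ∈ L²(0, ∞)`. On `(0, ∞)` such a representative is unique. -/
structure IsMaxRep (f : L2) (g : ℝ → ℂ) : Prop where
  ae_eq : f =ᵐ[volume.restrict (Set.Ioi (0 : ℝ))] g
  locAC : LocAC g
  locAC_deriv : LocAC (deriv g)
  memLp : MemLp (fun x => -deriv (deriv g) x) 2 (volume.restrict (Set.Ioi (0 : ℝ)))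

/-- The domain of the maximal operator of `-d²/dx²` on `(0, ∞)`. -/
def domKmax : Set L2 := {f | ∃ g : ℝ → ℂ, IsMaxRep f g}

/-- The domain of the minimal operator of `-d²/dx²` on `(0, ∞)`. -/
def domKmin : Set L2 :=
  {f | ∃ g : ℝ → ℂ, IsMaxRep f g ∧
    Tendsto g (𝓝[>] 0) (𝓝 0) ∧ Tendsto (deriv g) (𝓝[>] 0) (𝓝 0)}

/-- The continuous representative, with continuous derivative on `(0, ∞)`, of an element of the
maximal domain (and `0` for other classes). -/
def rep (f : L2) : ℝ → ℂ :=
  open Classical in if h : ∃ g : ℝ → ℂ, IsMaxRep f g then h.choose else 0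

/-- `f(0) := lim_{x → 0+} f(x)`. -/
def value0 (f : L2) : ℂ := limUnder (𝓝[>] (0 : ℝ)) (rep f)

/-- `f'(0) := lim_{x → 0+} f'(x)`. -/
def deriv0 (f : L2) : ℂ := limUnder (𝓝[>] (0 : ℝ)) (deriv (rep f))

theorem memLp_exp {z : ℂ} (hz : z.re < 0) (k : ℂ) :
    MemLp (fun x : ℝ => k * Complex.exp (z * x)) 2 (volume.restrict (Set.Ioi (0 : ℝ))) := by
  apply MemLp.const_mul
  rw [memLp_two_iff_integrable_sq_norm (by fun_prop)]
  have h := integrableOn_exp_mul_Ioi (a := 2 * z.re) (by linarith) 0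
  refine h.congr (Eventually.of_forall fun x => ?_)
  simp only [Complex.norm_exp, ← Real.exp_nat_mul]
  congr 1
  simp
  ring

theorem usqrt_neg_I_re : (usqrt (-Complex.I)).re < 0 := by
  rw [usqrt_neg_I]; simp

theorem neg_usqrt_I_re : (-usqrt Complex.I).re < 0 := by
  rw [usqrt_I]; simp

/-- The defect vector `φ⁺(x) = 2^{1/4} e^{√(-i) x}`. -/
def phiPlus : L2 :=
  (memLp_exp usqrt_neg_I_re (((2 : ℝ) ^ (1 / 4 : ℝ) : ℝ) : ℂ)).toLp _

/-- The defect vector `φ⁻(x) = 2^{1/4} e^{-√i x}`. -/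
def phiMinus : L2 :=
  (memLp_exp neg_usqrt_I_re (((2 : ℝ) ^ (1 / 4 : ℝ) : ℝ) : ℂ)).toLp _

/-- `dom K_{1,α} = dom K_{1,min} + span {α φ⁻ - φ⁺}`. -/
def domKalpha (α : ℂ) : Set L2 :=
  domKmin + (Submodule.span ℂ {α • phiMinus - phiPlus} : Set L2)

/-- `dom K₁(b, c) = {f ∈ dom K_{1,max} : b f(0) + c f'(0) = 0}`. -/
def domKbc (b c : ℂ) : Set L2 :=
  {f | f ∈ domKmax ∧ b * value0 f + c * deriv0 f = 0}

end HalfLine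

end

/-! Taking boundary values, f ↦ (f(0), f'(0)) is a linear map from the maximal domain to ℂ² whose
kernel is the minimal domain (`exists_hasTrace`, `HasTrace.add_smul`). Membership in either domain
thus depends only on this trace: for `domKalpha` it lies on the line spanned by the trace of αφ⁻ -
φ⁺, which is k(α - 1, -(α√i + √(-i))) with k = 2^{1/4}; for `domKbc` it lies on the line bv + cw =
0. The lines coincide iff the spanning vector satisfies the equation, that is α(b - c√i) = b +
c√(-i). The modulus claim holds because b = rc with r real and √(-i) is minus the conjugate of √i,
so numerator and denominator are c times conjugate numbers. -/

namespace HalfLine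

/-! ### Fundamental theorem of calculus for complex-valued absolutely continuous functions. -/

section AbsolutelyContinuous

variable {f : ℝ → ℂ} {a b : ℝ}

theorem absolutelyContinuousOnInterval_of_dist_le {X Y : Type*} [PseudoMetricSpace X]
    [PseudoMetricSpace Y] {f : ℝ → X} {g : ℝ → Y} {a b : ℝ}
    (hf : AbsolutelyContinuousOnInterval f a b)
    (h : ∀ x ∈ Set.uIcc a b, ∀ y ∈ Set.uIcc a b, dist (g x) (g y) ≤ dist (f x) (f y)) :
    AbsolutelyContinuousOnInterval g a b := by
  rw [absolutelyContinuousOnInterval_iff] at hf ⊢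
  intro ε hε
  obtain ⟨δ, hδ, H⟩ := hf ε hε
  refine ⟨δ, hδ, fun E hE hl => lt_of_le_of_lt (Finset.sum_le_sum fun i hi => ?_) (H E hE hl)⟩
  exact h _ (hE.1 i hi).1 _ (hE.1 i hi).2

theorem absolutelyContinuousOnInterval_re (hf : AbsolutelyContinuousOnInterval f a b) :
    AbsolutelyContinuousOnInterval (fun x => (f x).re) a b :=
  absolutelyContinuousOnInterval_of_dist_le hf fun x _ y _ => by
    rw [Real.dist_eq, dist_eq_norm, ← Complex.sub_re]
    exact Complex.abs_re_le_norm _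

theorem absolutelyContinuousOnInterval_im (hf : AbsolutelyContinuousOnInterval f a b) :
    AbsolutelyContinuousOnInterval (fun x => (f x).im) a b :=
  absolutelyContinuousOnInterval_of_dist_le hf fun x _ y _ => by
    rw [Real.dist_eq, dist_eq_norm, ← Complex.sub_im]
    exact Complex.abs_im_le_norm _

theorem ae_deriv_eq_re_im (hf : AbsolutelyContinuousOnInterval f a b) :
    ∀ᵐ x, x ∈ Set.uIcc a b →
      deriv f x = ((deriv (fun y => (f y).re) x : ℝ) : ℂ) +
        ((deriv (fun y => (f y).im) x : ℝ) : ℂ) * Complex.I := by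
  filter_upwards [(absolutelyContinuousOnInterval_re hf).ae_differentiableAt,
    (absolutelyContinuousOnInterval_im hf).ae_differentiableAt] with x h1 h2 hx
  have h := (h1 hx).hasDerivAt.ofReal_comp.add ((h2 hx).hasDerivAt.ofReal_comp.mul_const Complex.I)
  rw [← h.deriv]
  congr 1
  ext y
  simp [Complex.re_add_im]

/-- Reduces to the real theorem for the real and imaginary parts, whose derivatives recombine to
that of `f` almost everywhere. -/
theorem integral_deriv_eq_sub_complex (hf : AbsolutelyContinuousOnInterval f a b) :
    ∫ x in a..b, deriv f x = f b - f a := by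
  have h1 := (absolutelyContinuousOnInterval_re hf).intervalIntegrable_deriv
  have h2 := (absolutelyContinuousOnInterval_im hf).intervalIntegrable_deriv
  have h1' : IntervalIntegrable (fun x => ((deriv (fun y => (f y).re) x : ℝ) : ℂ)) volume a b :=
    ⟨h1.1.ofReal, h1.2.ofReal⟩
  have h2' : IntervalIntegrable (fun x => ((deriv (fun y => (f y).im) x : ℝ) : ℂ)) volume a b :=
    ⟨h2.1.ofReal, h2.2.ofReal⟩
  rw [intervalIntegral.integral_congr_ae (g := fun x => ((deriv (fun y => (f y).re) x : ℝ) : ℂ) +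
        ((deriv (fun y => (f y).im) x : ℝ) : ℂ) * Complex.I),
    intervalIntegral.integral_add h1' (h2'.mul_const _),
    intervalIntegral.integral_mul_const, intervalIntegral.integral_ofReal,
    intervalIntegral.integral_ofReal, (absolutelyContinuousOnInterval_re hf).integral_deriv_eq_sub,
    (absolutelyContinuousOnInterval_im hf).integral_deriv_eq_sub]
  · apply Complex.ext <;> simp
  · filter_upwards [ae_deriv_eq_re_im hf] with x hx hx'
    exact hx (Set.uIoc_subset_uIcc hx')

end AbsolutelyContinuous

/-! ### Local absolute continuity on (0, ∞) and behaviour at 0. -/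

section LocAC

variable {f g : ℝ → ℂ}

theorem LocAC.congr (hf : LocAC f) (h : Set.EqOn f g (Set.Ioi 0)) : LocAC g := by
  intro x y hx hxy
  refine absolutelyContinuousOnInterval_of_dist_le (hf x y hx hxy) fun s hs t ht => ?_
  rw [Set.uIcc_of_le hxy] at hs ht
  rw [h (lt_of_lt_of_le hx hs.1), h (lt_of_lt_of_le hx ht.1)]

theorem LocAC.uIcc (hf : LocAC f) {x y : ℝ} (hx : 0 < x) (hy : 0 < y) :
    AbsolutelyContinuousOnInterval f x y := by
  rcases le_total x y with h | h
  · exact hf x y hx h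
  · exact (hf y x hy h).symm

theorem LocAC.add_const_smul (hf : LocAC f) (hg : LocAC g) (c : ℂ) :
    LocAC (fun x => f x + c * g x) :=
  fun x y hx hxy => (hf x y hx hxy).fun_add ((hg x y hx hxy).const_smul c)

theorem LocAC.continuousOn (hf : LocAC f) : ContinuousOn f (Set.Ioi 0) := by
  intro x hx
  have hx' : 0 < x := hx
  have h := (hf (x / 2) (x + 1) (by positivity) (by linarith)).continuousOn
  rw [Set.uIcc_of_le (by linarith)] at h
  exact (h.continuousAt (Icc_mem_nhds (by linarith) (by linarith))).continuousWithinAt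

theorem LocAC.ae_differentiableAt (hf : LocAC f) :
    ∀ᵐ x ∂volume.restrict (Set.Ioi (0 : ℝ)), DifferentiableAt ℝ f x := by
  have h : LocallyBoundedVariationOn f (Set.Ioi 0) := by
    intro x y hx hy
    exact (hf.uIcc hx hy).boundedVariationOn.mono
      (Set.inter_subset_right.trans Set.Icc_subset_uIcc)
  filter_upwards [h.ae_differentiableWithinAt measurableSet_Ioi,
    ae_restrict_mem measurableSet_Ioi] with x hx hx'
  exact hx.differentiableAt (Ioi_mem_nhds hx')

/-- The extension is f(1) - ∫ₓ¹ f', continuous up to 0 because f' is integrable there. -/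
theorem LocAC.exists_continuousOn_extension (hf : LocAC f)
    (hi : IntegrableOn (deriv f) (Set.Ioc 0 1)) :
    ∃ h : ℝ → ℂ, ContinuousOn h (Set.Icc 0 1) ∧ Set.EqOn f h (Set.Ioc 0 1) := by
  refine ⟨fun x => f 1 - ∫ t in x..1, deriv f t, ?_, fun x hx => ?_⟩
  · have := intervalIntegral.continuousOn_primitive_interval_left (a := (0 : ℝ)) (b := 1)
      (f := deriv f) (μ := volume)
      (by rw [Set.uIcc_of_le zero_le_one]; exact (integrableOn_Icc_iff_integrableOn_Ioc (by simp)).2 hi)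
    rw [Set.uIcc_of_le zero_le_one] at this
    exact continuousOn_const.sub this
  · simp only
    rw [integral_deriv_eq_sub_complex (hf x 1 hx.1 hx.2)]
    ring

theorem tendsto_of_continuousOn_extension {f h : ℝ → ℂ} (hc : ContinuousOn h (Set.Icc 0 1))
    (he : Set.EqOn f h (Set.Ioc 0 1)) : Tendsto f (𝓝[>] 0) (𝓝 (h 0)) := by
  have h1 : Tendsto h (𝓝[>] 0) (𝓝 (h 0)) :=
    (hc 0 (by simp)).tendsto.mono_left
      (nhdsWithin_le_of_mem (Icc_mem_nhdsGT zero_lt_one))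
  refine h1.congr' ?_
  filter_upwards [Ioc_mem_nhdsGT (zero_lt_one : (0 : ℝ) < 1)] with x hx
  exact (he hx).symm

/-- Absolute continuity alone gives differentiability only almost everywhere; since `deriv f` is
continuous, writing f as its primitive gives it at every point. -/
theorem LocAC.hasDerivAt (hf : LocAC f) (hf' : LocAC (deriv f)) {x : ℝ} (hx : 0 < x) :
    HasDerivAt f (deriv f x) x := by
  have hc := hf'.continuousOn
  have h1 : HasDerivAt (fun y => f x + ∫ t in x..y, deriv f t) (deriv f x) x :=
    (intervalIntegral.integral_hasDerivAt_right (by simp)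
      (hc.stronglyMeasurableAtFilter isOpen_Ioi x hx)
      (hc.continuousAt (Ioi_mem_nhds hx))).const_add _
  refine h1.congr_of_eventuallyEq ?_
  filter_upwards [Ioi_mem_nhds hx] with y hy
  rw [integral_deriv_eq_sub_complex (hf.uIcc hx hy)]
  ring

end LocAC

/-! ### Boundary values of elements of the maximal domain. -/

section Trace

/-- Continuous functions equal a.e. on an open set agree there; hence boundary values do not depend
on the representative chosen in `rep`. -/
theorem IsMaxRep.eqOn {f : L2} {g h : ℝ → ℂ} (hg : IsMaxRep f g) (hh : IsMaxRep f h) :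
    Set.EqOn g h (Set.Ioi 0) :=
  Measure.eqOn_open_of_ae_eq (hg.ae_eq.symm.trans hh.ae_eq) isOpen_Ioi
    hg.locAC.continuousOn hh.locAC.continuousOn

theorem IsMaxRep.deriv_eqOn {f : L2} {g h : ℝ → ℂ} (hg : IsMaxRep f g) (hh : IsMaxRep f h) :
    Set.EqOn (deriv g) (deriv h) (Set.Ioi 0) := fun _ hx =>
  ((hg.eqOn hh).eventuallyEq_of_mem (Ioi_mem_nhds hx)).deriv_eq

/-- `f` lies in the maximal domain and has boundary values `f(0) = v`, `f'(0) = w`. -/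
def HasTrace (f : L2) (v w : ℂ) : Prop :=
  ∃ g : ℝ → ℂ, IsMaxRep f g ∧ Tendsto g (𝓝[>] 0) (𝓝 v) ∧ Tendsto (deriv g) (𝓝[>] 0) (𝓝 w)

theorem HasTrace.mem_domKmax {f : L2} {v w : ℂ} (h : HasTrace f v w) : f ∈ domKmax :=
  let ⟨g, hg, _⟩ := h
  ⟨g, hg⟩

theorem isMaxRep_rep {f : L2} (hf : f ∈ domKmax) : IsMaxRep f (rep f) := by
  have hf' : ∃ g : ℝ → ℂ, IsMaxRep f g := hf
  unfold rep
  rw [dif_pos hf']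
  exact hf'.choose_spec

theorem HasTrace.value0_eq {f : L2} {v w : ℂ} (h : HasTrace f v w) : value0 f = v := by
  obtain ⟨g, hg, h1, -⟩ := h
  refine (h1.congr' ?_).limUnder_eq
  exact eventually_mem_nhdsWithin.mono (hg.eqOn (isMaxRep_rep ⟨g, hg⟩))

theorem HasTrace.deriv0_eq {f : L2} {v w : ℂ} (h : HasTrace f v w) : deriv0 f = w := by
  obtain ⟨g, hg, -, h2⟩ := h
  refine (h2.congr' ?_).limUnder_eq
  exact eventually_mem_nhdsWithin.mono (hg.deriv_eqOn (isMaxRep_rep ⟨g, hg⟩))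

/-- On (0, 1], L² is contained in L¹, so g'' is integrable and g' extends continuously to 0; then g'
is integrable too, and g extends likewise. -/
theorem exists_hasTrace {f : L2} (hf : f ∈ domKmax) : ∃ v w, HasTrace f v w := by
  obtain ⟨g, hg⟩ := hf
  have h2 : IntegrableOn (deriv (deriv g)) (Set.Ioc 0 1) := by
    have h3 : MemLp (fun x => -deriv (deriv g) x) 2 (volume.restrict (Set.Ioc (0 : ℝ) 1)) :=
      hg.memLp.mono_measure (Measure.restrict_mono Set.Ioc_subset_Ioi_self le_rfl)
    refine (h3.integrable (by norm_num)).neg.congr (Eventually.of_forall fun x => ?_)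
    simp
  obtain ⟨u, hu, hu'⟩ := hg.locAC_deriv.exists_continuousOn_extension h2
  have h1 : IntegrableOn (deriv g) (Set.Ioc 0 1) :=
    ((hu.integrableOn_Icc).mono_set Set.Ioc_subset_Icc_self).congr_fun hu'.symm measurableSet_Ioc
  obtain ⟨r, hr, hr'⟩ := hg.locAC.exists_continuousOn_extension h1
  exact ⟨r 0, u 0, g, hg, tendsto_of_continuousOn_extension hr hr',
    tendsto_of_continuousOn_extension hu hu'⟩

theorem HasTrace.add_smul {f f' : L2} {v w v' w' : ℂ} (h : HasTrace f v w)
    (h' : HasTrace f' v' w') (c : ℂ) : HasTrace (f + c • f') (v + c * v') (w + c * w') := by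
  obtain ⟨g, hg, h1, h2⟩ := h
  obtain ⟨g', hg', h1', h2'⟩ := h'
  have hd : Set.EqOn (fun x => deriv g x + c * deriv g' x) (deriv fun x => g x + c * g' x)
      (Set.Ioi 0) := fun x hx =>
    ((hg.locAC.hasDerivAt hg.locAC_deriv hx).add
      ((hg'.locAC.hasDerivAt hg'.locAC_deriv hx).const_mul c)).deriv.symm
  refine ⟨fun x => g x + c * g' x, ⟨?_, hg.locAC.add_const_smul hg'.locAC c,
    (hg.locAC_deriv.add_const_smul hg'.locAC_deriv c).congr hd, ?_⟩,
    h1.add (h1'.const_mul c), ?_⟩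
  · filter_upwards [Lp.coeFn_add f (c • f'), Lp.coeFn_smul c f', hg.ae_eq, hg'.ae_eq]
      with x a1 a2 a3 a4
    rw [a1, Pi.add_apply, a2, Pi.smul_apply, a3, a4, smul_eq_mul]
  · refine MemLp.ae_eq ?_ (hg.memLp.add (hg'.memLp.const_mul c))
    -- First derivatives add at every point of (0, ∞), second derivatives only almost everywhere,
    -- which suffices for L².
    filter_upwards [hg.locAC_deriv.ae_differentiableAt, hg'.locAC_deriv.ae_differentiableAt,
      ae_restrict_mem measurableSet_Ioi] with x a1 a2 hx
    rw [← (hd.eventuallyEq_of_mem (Ioi_mem_nhds hx)).deriv_eq,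
      (a1.hasDerivAt.fun_add (a2.hasDerivAt.const_mul c)).deriv]
    simp only [Pi.add_apply]
    ring
  · exact (h2.add (h2'.const_mul c)).congr' (eventually_mem_nhdsWithin.mono hd)

theorem hasDerivAt_const_mul_exp (k z : ℂ) (x : ℝ) :
    HasDerivAt (fun x : ℝ => k * Complex.exp (z * x)) (k * z * Complex.exp (z * x)) x := by
  have h := ((((hasDerivAt_id x).ofReal_comp).const_mul z).cexp).const_mul k
  simp only [id_eq, Complex.ofReal_one, mul_one] at h
  exact h.congr_deriv (by ring)

theorem locAC_const_mul_exp (k z : ℂ) : LocAC (fun x : ℝ => k * Complex.exp (z * x)) :=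
  fun _ _ _ _ => ContDiffOn.absolutelyContinuousOnInterval
    (contDiff_const.mul ((contDiff_const.mul Complex.ofRealCLM.contDiff).cexp)).contDiffOn

theorem tendsto_const_mul_exp (k z : ℂ) :
    Tendsto (fun x : ℝ => k * Complex.exp (z * x)) (𝓝[>] 0) (𝓝 k) := by
  have h : Continuous (fun x : ℝ => k * Complex.exp (z * x)) := by fun_prop
  simpa using (h.tendsto 0).mono_left nhdsWithin_le_nhds

theorem hasTrace_exp {z : ℂ} (hz : z.re < 0) (k : ℂ) :
    HasTrace ((memLp_exp hz k).toLp _) k (k * z) := by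
  have hd (k : ℂ) : deriv (fun x : ℝ => k * Complex.exp (z * x)) =
      fun x : ℝ => k * z * Complex.exp (z * x) :=
    funext fun x => (hasDerivAt_const_mul_exp k z x).deriv
  refine ⟨_, ⟨(memLp_exp hz k).coeFn_toLp, locAC_const_mul_exp k z, ?_, ?_⟩,
    tendsto_const_mul_exp k z, ?_⟩
  · rw [hd]
    exact locAC_const_mul_exp _ z
  · rw [hd, hd]
    exact (memLp_exp hz _).neg
  · rw [hd]
    exact tendsto_const_mul_exp _ z

end Trace

/-! ### Comparison of the two boundary conditions. -/

section BoundaryConditions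

/-- The normalization constant `2^{1/4}` of the defect vectors. -/
noncomputable def defectConst : ℂ := (((2 : ℝ) ^ (1 / 4 : ℝ) : ℝ) : ℂ)

theorem defectConst_ne_zero : defectConst ≠ 0 :=
  Complex.ofReal_ne_zero.2 (Real.rpow_pos_of_pos two_pos _).ne'

theorem hasTrace_defect (α : ℂ) : HasTrace (α • phiMinus - phiPlus) (defectConst * (α - 1))
    (-(defectConst * (α * usqrt Complex.I + usqrt (-Complex.I)))) := by
  have h0 : HasTrace phiPlus _ _ := hasTrace_exp usqrt_neg_I_re defectConst
  have h1 : HasTrace phiMinus _ _ := hasTrace_exp neg_usqrt_I_re defectConst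
  -- The coefficient -2 turns φ⁺ into φ⁺ - 2φ⁺ = -φ⁺.
  have h := (h0.add_smul h0 (-2)).add_smul h1 α
  convert h using 1
  · module
  · ring
  · ring

theorem usqrt_I_add_usqrt_neg_I_ne_zero : usqrt Complex.I + usqrt (-Complex.I) ≠ 0 := by
  rw [usqrt_I, usqrt_neg_I]
  intro h
  have := congrArg Complex.im h
  simp at this

theorem usqrt_neg_I_eq_neg_conj : usqrt (-Complex.I) = -(starRingEnd ℂ) (usqrt Complex.I) := by
  rw [usqrt_I, usqrt_neg_I]
  apply Complex.ext <;> simp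

theorem usqrt_I_im_ne_zero : (usqrt Complex.I).im ≠ 0 := by
  rw [usqrt_I]
  simp

/-- Since |c| = 1, b = (b c̄)c, and b c̄ is real. This reduces the boundary condition to a real
parameter r. -/
theorem exists_real_eq_mul {b c : ℂ} (hc : ‖c‖ = 1) (hbc : (b * (starRingEnd ℂ) c).im = 0) :
    ∃ r : ℝ, b = r * c := by
  refine ⟨(b * (starRingEnd ℂ) c).re, ?_⟩
  have h1 : (((b * (starRingEnd ℂ) c).re : ℝ) : ℂ) = b * (starRingEnd ℂ) c :=
    Complex.ext (by simp) (by rw [Complex.ofReal_im, hbc])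
  rw [h1, mul_assoc, mul_comm _ c, Complex.mul_conj, Complex.normSq_eq_norm_sq, hc]
  simp

theorem sub_mul_usqrt_I_ne_zero {b c : ℂ} (hc : ‖c‖ = 1)
    (hbc : (b * (starRingEnd ℂ) c).im = 0) : b - c * usqrt Complex.I ≠ 0 := by
  obtain ⟨r, rfl⟩ := exists_real_eq_mul hc hbc
  have hc0 : c ≠ 0 := norm_ne_zero_iff.1 (by rw [hc]; exact one_ne_zero)
  have h : (r : ℂ) - usqrt Complex.I ≠ 0 := fun h => usqrt_I_im_ne_zero (by
    have := congrArg Complex.im h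
    simpa using this)
  have := mul_ne_zero hc0 h
  rwa [mul_sub, mul_comm c (r : ℂ)] at this

theorem norm_add_eq_norm_sub {b c : ℂ} (hc : ‖c‖ = 1) (hbc : (b * (starRingEnd ℂ) c).im = 0) :
    ‖b + c * usqrt (-Complex.I)‖ = ‖b - c * usqrt Complex.I‖ := by
  obtain ⟨r, rfl⟩ := exists_real_eq_mul hc hbc
  have h1 : r * c + c * usqrt (-Complex.I) = c * (starRingEnd ℂ) (r - usqrt Complex.I) := by
    rw [usqrt_neg_I_eq_neg_conj, map_sub, Complex.conj_ofReal]
    ring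
  have h2 : r * c - c * usqrt Complex.I = c * (r - usqrt Complex.I) := by ring
  rw [h1, h2, norm_mul, norm_mul, Complex.norm_conj]

/-- The two domains agree iff `α φ⁻ - φ⁺` satisfies `b f(0) + c f'(0) = 0`. -/
theorem domKalpha_eq_domKbc_iff {α b c : ℂ} (hb : b ≠ 0) :
    domKalpha α = domKbc b c ↔
      b * (α - 1) = c * (α * usqrt Complex.I + usqrt (-Complex.I)) := by
  have hk := defectConst_ne_zero
  have hd := hasTrace_defect α
  constructor
  · intro h
    have hz : HasTrace (0 : L2) 0 0 := by
      simpa using hd.add_smul hd (-1)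
    have hm : α • phiMinus - phiPlus ∈ domKalpha α :=
      Set.mem_add.2 ⟨0, hz, _, Submodule.mem_span_singleton_self _, zero_add _⟩
    rw [h] at hm
    have h2 := hm.2
    rw [hd.value0_eq, hd.deriv0_eq] at h2
    apply mul_left_cancel₀ hk
    linear_combination h2
  · intro h
    ext f
    constructor
    · intro hf
      obtain ⟨m, hm, s, hs, rfl⟩ := Set.mem_add.1 hf
      obtain ⟨t, rfl⟩ := Submodule.mem_span_singleton.1 hs
      have hm' : HasTrace m 0 0 := hm
      have ht := hm'.add_smul hd t
      refine ⟨ht.mem_domKmax, ?_⟩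
      rw [ht.value0_eq, ht.deriv0_eq]
      linear_combination t * defectConst * h
    · rintro ⟨hf, h0⟩
      obtain ⟨v, w, hvw⟩ := exists_hasTrace hf
      rw [hvw.value0_eq, hvw.deriv0_eq] at h0
      -- If the derivative of αφ⁻ - φ⁺ vanished at 0, the boundary condition and b ≠ 0 would force α
      -- = 1, contradicting √i + √(-i) ≠ 0.
      have hq : α * usqrt Complex.I + usqrt (-Complex.I) ≠ 0 := by
        intro hq
        rw [hq, mul_zero] at h
        have hα : α = 1 := sub_eq_zero.1 ((mul_eq_zero.1 h).resolve_left hb)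
        rw [hα, one_mul] at hq
        exact usqrt_I_add_usqrt_neg_I_ne_zero hq
      set q := α * usqrt Complex.I + usqrt (-Complex.I) with hqdef
      -- Chosen so that f - t(αφ⁻ - φ⁺) has zero derivative at 0; its value at 0 then vanishes by
      -- the boundary condition, as b ≠ 0.
      set t : ℂ := -w / (defectConst * q) with ht
      have htw : t * (defectConst * q) = -w := div_mul_cancel₀ _ (mul_ne_zero hk hq)
      have hm := hvw.add_smul hd (-t)
      refine Set.mem_add.2 ⟨f + (-t) • (α • phiMinus - phiPlus), ?_,
        t • (α • phiMinus - phiPlus), Submodule.smul_mem _ _ (Submodule.mem_span_singleton_self _),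
        by module⟩
      change HasTrace _ 0 0
      convert hm using 1
      · apply mul_left_cancel₀ hb
        linear_combination -h0 + c * htw + t * defectConst * h
      · linear_combination -htw

end BoundaryConditions

end HalfLine

theorem mainTheorem11 (α b c : ℂ) (hα : ‖α‖ = 1) (hb : ‖b‖ = 1) (hc : ‖c‖ = 1)
    (hbc : (b * (starRingEnd ℂ) c).im = 0) :
    b - c * HalfLine.usqrt Complex.I ≠ 0 ∧
    ‖(b + c * HalfLine.usqrt (-Complex.I)) / (b - c * HalfLine.usqrt Complex.I)‖ = 1 ∧
    (HalfLine.domKalpha α = HalfLine.domKbc b c ↔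
      α = (b + c * HalfLine.usqrt (-Complex.I)) / (b - c * HalfLine.usqrt Complex.I)) := by
  have h0 := HalfLine.sub_mul_usqrt_I_ne_zero hc hbc
  have hb0 : b ≠ 0 := norm_ne_zero_iff.1 (by rw [hb]; exact one_ne_zero)
  refine ⟨h0, ?_, ?_⟩
  · rw [norm_div, HalfLine.norm_add_eq_norm_sub hc hbc, div_self (norm_ne_zero_iff.2 h0)]
  · rw [HalfLine.domKalpha_eq_domKbc_iff hb0, eq_div_iff h0]
    constructor <;> intro h <;> linear_combination h
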